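/- Let $(X,\rho)$ be a non-empty bounded pseudo-metric space. For $\delta>0$ let $N_\delta^\rho(X)\in\mathbb N\cup\{\infty\}$ be the minimal number of closed balls $\{y\in X:\rho(x,y)\le\delta\}$, with centres $x\in X$, needed to cover $X$, and let $$\overline{\dim}_B^{\rho}(X):=\limsup_{\delta\to0^+}\frac{\log N_\delta^\rho(X)}{\log(1/\delta)}\in[0,\infty]$$ be the upper box-counting dimension. For a finite set $W\subseteq X$, a Vietoris–Rips filtration of $W$ is a sequence of simplicial complexes $\emptyset=K^0\subset K^1\subset\dots\subset K^N$, where $K^N$ consists of all non-empty subsets of $W$ and $K^{i}=K^{i-1}\cup\{s_i\}$ for a single new simplex $s_i$; the simplices are added in increasing order of their scale $\delta(s)=\max_{x,y\in s}\rho(x,y)$, those of equal scale in increasing order of dimension, and those of equal scale and dimension in arbitrary order. Let $\mathrm{PH}^0$ be the multiset of pairs $(0,\delta(s_i))$, one for each $i$ such that $K^{i}$ has one connected component less than $K^{i-1}$. For $\alpha>0$ put $E_\alpha(W):=\sum_{(b,d)\in\mathrm{PH}^0}(d-b)^\alpha$, and let $$\dim_{\mathrm{PH}^0}^{\rho}(X):=\inf\{\alpha>0:\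 \exists C>0\ \ \forall W\subseteq X\text{ finite},\ E_\alpha(W)<C\}\in[0,\infty],\qquad \inf\emptyset=\infty,$$ be the persistent homology dimension of degree $0$, where the bound $E_\alpha(W)<C$ is required for every choice of the Vietoris–Rips filtration of $W$. Then $$\overline{\dim}_B^{\rho}(X)=\dim_{\mathrm{PH}^0}^{\rho}(X).$$ -/

import Mathlib

open Filter Topology
open scoped NNReal ENNReal

noncomputable section

namespace PHDim

universe u

/-- The upper box-counting dimension of a (pseudo-)metric space,
`limsup_{δ → 0⁺} log N_δ / log (1/δ)`, where `N_δ` is the minimal number of closed `δ`-balls with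
centres in `X` that cover `X`.  It is an extended real number (equal to `⊤` when `N_δ = ∞` for
small `δ`). -/
def upperBoxDim (X : Type u) [PseudoMetricSpace X] : EReal :=
  limsup (fun δ : ℝ≥0 =>
      ENNReal.log ((Metric.coveringNumber δ (Set.univ : Set X) : ℕ∞) : ℝ≥0∞) /
        ((Real.log (1 / (δ : ℝ)) : ℝ) : EReal))
    (𝓝[>] (0 : ℝ≥0))

section Complexes

variable {X : Type u}

/-- The graph of a simplicial complex: its nodes are the vertices of the complex, and two distinct
vertices are adjacent when they lie in a common simplex (equivalently, span an edge of the
complex). -/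
def skeletonGraph (K : PreAbstractSimplicialComplex X) : SimpleGraph {v : X // {v} ∈ K} where
  Adj v w := v ≠ w ∧ ∃ s ∈ K, v.1 ∈ s ∧ w.1 ∈ s
  symm := ⟨fun _ _ h => ⟨h.1.symm, h.2.imp fun _ hs => ⟨hs.1, hs.2.2, hs.2.1⟩⟩⟩
  loopless := ⟨fun _ h => h.1 rfl⟩

/-- The number of connected components of a (finite) simplicial complex. -/
def numComponents (K : PreAbstractSimplicialComplex X) : ℕ :=
  Nat.card (skeletonGraph K).ConnectedComponent

/-- A filtration of a finite simplicial complex `L`: an increasing sequence of complexes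
`∅ = K⁰ ⊂ K¹ ⊂ ⋯ ⊂ Kᴺ = L`, each obtained from the previous one by adding one simplex. -/
structure SimplexFiltration (L : PreAbstractSimplicialComplex X) where
  /-- the number of simplices -/
  length : ℕ
  /-- the complexes -/
  complex : Fin (length + 1) → PreAbstractSimplicialComplex X
  /-- the simplex that is added at each step -/
  simplex : Fin length → Finset X
  complex_zero : complex 0 = ⊥
  complex_last : complex (Fin.last length) = L
  simplex_notMem : ∀ i, simplex i ∉ complex i.castSucc
  complex_succ : ∀ i, (complex i.succ).faces = insert (simplex i) (complex i.castSucc).faces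

/-- The complex of all non-empty subsets of the finite set `W`. -/
def fullComplex (W : Finset X) : PreAbstractSimplicialComplex X where
  faces := {s | s.Nonempty ∧ s ⊆ W}
  isRelLowerSet_faces := fun _ hs => ⟨hs.1, fun _ hts ht => ⟨ht, hts.trans hs.2⟩⟩

end Complexes

section Rips

variable {X : Type u} [PseudoMetricSpace X]

/-- The Vietoris–Rips complex of a finite set `W` at scale `δ`: its simplices are the non-empty
subsets of `W` whose points are at pairwise distance at most `δ`. -/
def ripsComplex (W : Finset X) (δ : ℝ) : PreAbstractSimplicialComplex X where
  faces := {s | (s.Nonempty ∧ s ⊆ W) ∧ ∀ x ∈ s, ∀ y ∈ s, dist x y ≤ δ}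
  isRelLowerSet_faces := fun _ hs =>
    ⟨hs.1.1, fun _ hts ht =>
      ⟨⟨ht, hts.trans hs.1.2⟩, fun x hx y hy => hs.2 x (hts hx) y (hts hy)⟩⟩

/-- The diameter of a simplex is the scale at which it enters the Vietoris–Rips complex. -/
theorem mem_ripsComplex_iff {W s : Finset X} {δ : ℝ} (hs : s.Nonempty) (hW : s ⊆ W) :
    s ∈ ripsComplex W δ ↔ Metric.diam (s : Set X) ≤ δ := by
  constructor
  · intro h
    obtain ⟨x, hx⟩ := hs
    exact Metric.diam_le_of_forall_dist_le (dist_nonneg.trans (h.2 x hx x hx))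
      (fun a ha b hb => h.2 a ha b hb)
  · intro h
    exact ⟨⟨hs, hW⟩, fun x hx y hy =>
      (Metric.dist_le_diam_of_mem s.finite_toSet.isBounded hx hy).trans h⟩

/-- A Vietoris–Rips filtration of a finite set `W`: the simplices on `W` are added one by one, in
increasing order of the scale at which they enter the Vietoris–Rips complex; simplices that enter
at the same scale are ordered by dimension, and arbitrarily if they also have the same
dimension. -/
structure RipsFiltration (W : Finset X) extends SimplexFiltration (fullComplex W) where
  sorted : Monotone fun i =>
    toLex (Metric.diam (simplex i : Set X), (simplex i).card)

/-- Every finite set has a Vietoris–Rips filtration. -/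
theorem nonempty_ripsFiltration (W : Finset X) : Nonempty (RipsFiltration W) := by
  classical
  let S := {s : Finset X // s ∈ W.powerset.erase ∅}
  let e : S ≃ Fin (Fintype.card S) := Fintype.equivFin S
  let f : Fin (Fintype.card S) → ℝ ×ₗ ℕ := fun i =>
    toLex (Metric.diam ((e.symm i).1 : Set X), (e.symm i).1.card)
  let g : Fin (Fintype.card S) ≃ S := (Tuple.sort f).trans e.symm
  have hg : Monotone fun i => toLex (Metric.diam ((g i).1 : Set X), (g i).1.card) :=
    Tuple.monotone_sort f
  have hmem : ∀ i, ((g i).1).Nonempty ∧ (g i).1 ⊆ W := by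
    intro i
    have := (g i).2
    rw [Finset.mem_erase, Finset.mem_powerset] at this
    exact ⟨Finset.nonempty_iff_ne_empty.2 this.1, this.2⟩
  have hsurj : ∀ s : Finset X, s.Nonempty → s ⊆ W → ∃ j, (g j).1 = s := by
    intro s h1 h2
    refine ⟨g.symm ⟨s, ?_⟩, by simp⟩
    rw [Finset.mem_erase, Finset.mem_powerset]
    exact ⟨h1.ne_empty, h2⟩
  have hinj : ∀ i j, (g i).1 = (g j).1 → i = j := fun i j h => g.injective (Subtype.ext h)
  refine ⟨{
    length := Fintype.card S
    complex := fun i =>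
      { faces := {s | ∃ j, j.castSucc < i ∧ (g j).1 = s}
        isRelLowerSet_faces := ?_ }
    simplex := fun i => (g i).1
    complex_zero := ?_
    complex_last := ?_
    simplex_notMem := ?_
    complex_succ := ?_
    sorted := hg }⟩
  · rintro s ⟨j, hj, rfl⟩
    refine ⟨(hmem j).1, fun t hts ht => ?_⟩
    obtain ⟨k, hk⟩ := hsurj t ht (hts.trans (hmem j).2)
    refine ⟨k, lt_of_le_of_lt (Fin.castSucc_le_castSucc_iff.2 ?_) hj, hk⟩
    by_contra hlt
    have hle := hg (le_of_lt (not_le.1 hlt))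
    have hdiam : Metric.diam (t : Set X) ≤ Metric.diam ((g j).1 : Set X) :=
      Metric.diam_mono (by exact_mod_cast hts) (g j).1.finite_toSet.isBounded
    have hts' : t ⊂ (g j).1 := lt_of_le_of_ne hts (by
      intro h
      exact hlt (hinj k j (hk.trans h)).le)
    have hcard := Finset.card_lt_card hts'
    simp only [hk, Prod.Lex.toLex_le_toLex] at hle
    rcases hle with h | ⟨_, h⟩
    · exact absurd h (not_lt.2 hdiam)
    · omega
  · ext s
    constructor
    · rintro ⟨j, hj, -⟩
      exact absurd hj (Fin.not_lt_zero _)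
    · intro h
      exact h.elim
  · ext s
    constructor
    · rintro ⟨j, -, rfl⟩
      exact hmem j
    · rintro ⟨h1, h2⟩
      obtain ⟨j, hj⟩ := hsurj s h1 h2
      exact ⟨j, Fin.castSucc_lt_last j, hj⟩
  · rintro i ⟨j, hj, h⟩
    rw [hinj j i h] at hj
    exact lt_irrefl _ hj
  · intro i
    ext s
    simp only [Set.mem_insert_iff, Set.mem_ofPred_eq, Fin.castSucc_lt_succ_iff,
      Fin.castSucc_lt_castSucc_iff]
    constructor
    · rintro ⟨j, hj, rfl⟩
      rcases hj.lt_or_eq with h | h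
      · exact Or.inr ⟨j, h, rfl⟩
      · exact Or.inl (by rw [h])
    · rintro (rfl | ⟨j, hj, rfl⟩)
      · exact ⟨i, le_rfl, rfl⟩
      · exact ⟨j, hj.le, rfl⟩

open Classical in
/-- Persistent homology of degree `0` of a Vietoris–Rips filtration: the multiset of the pairs
`(birth, death) = (0, δ)`, one for each step of the filtration at which the number of connected
components drops by one, `δ` being the scale of that step. -/
def persistentHomologyZero {W : Finset X} (F : RipsFiltration W) : Multiset (ℝ × ℝ) :=
  (Finset.univ.filter fun i : Fin F.length =>
      numComponents (F.complex i.succ) + 1 = numComponents (F.complex i.castSucc)).val.map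
    fun i => ((0 : ℝ), Metric.diam (F.simplex i : Set X))

/-- The `α`-weighted sum of lifetimes `∑ (death - birth) ^ α`. -/
def lifetimeSum (α : ℝ) {W : Finset X} (F : RipsFiltration W) : ℝ :=
  ((persistentHomologyZero F).map fun p => (p.2 - p.1) ^ α).sum

end Rips

/-- The persistent homology dimension of degree `0`: the infimum (in the extended reals, with
`inf ∅ = ⊤`) of the `α > 0` for which the `α`-weighted lifetime sums of all finite subsets of `X`
are bounded by one constant.  The bound is required for every Vietoris–Rips filtration of the
finite subset, i.e. for every way of breaking ties; such filtrations always exist. -/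
def phDimZero (X : Type u) [PseudoMetricSpace X] : EReal :=
  sInf {a : EReal | ∃ α : ℝ, a = (α : EReal) ∧ 0 < α ∧
    ∃ C : ℝ, 0 < C ∧ ∀ (W : Finset X) (F : RipsFiltration W), lifetimeSum α F < C}

end PHDim

end

/-! Degree-zero persistence records mergers of components. Along a filtration of `W` the component
count goes from 0 to at most 1; a vertex raises it, any other simplex keeps it or lowers it by one.
Telescoping gives at least `W.card - 1` merges (`card_le_card_mergeSteps_add_one`) and, from a stage
after which no vertex enters, at most as many merges as there are components at that stage
(`card_mergeSteps_filter_le`).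

If `W` is δ-separated, every merge has scale above δ, so (|W| - 1) δ^α ≤ E_α(W). A bound C on E_α
thus bounds packing numbers, hence covering numbers, by 1 + C δ^(-α), and the box dimension is at
most α.

Conversely, points in one ε-ball are joined by an edge of length at most 2ε, so once all such edges
are present at most N_ε components remain, and at most N_ε merges have scale above 2ε
(`card_long_merges_le`). If N_ε ≤ ε^(-β) for small ε and α > β, dyadic grouping of the lifetimes
bounds E_α by a geometric series, uniformly in `W` (`sum_rpow_le_of_card_le`). -/

namespace SimpleGraph

/-! ### Component counts of graphs -/

variable {V V' : Type*} {G : SimpleGraph V} {G' : SimpleGraph V'}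

theorem card_connectedComponent_le_of_surjective [Finite V] (φ : G →g G')
    (hφ : Function.Surjective φ) :
    Nat.card G'.ConnectedComponent ≤ Nat.card G.ConnectedComponent := by
  have : Finite G.ConnectedComponent := Quot.finite _
  refine Nat.card_le_card_of_surjective (ConnectedComponent.map φ) fun C => ?_
  induction C using ConnectedComponent.ind with | _ v' =>
  obtain ⟨v, rfl⟩ := hφ v'
  exact ⟨G.connectedComponentMk v, rfl⟩

/-- Adding edges only between two fixed vertices lowers the number of components by at most one. -/
theorem card_connectedComponent_le_add_one [Finite V'] (φ : G →g G')
    (hφ : Function.Bijective φ) (a b : V)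
    (h : ∀ x y, G'.Adj (φ x) (φ y) → G.Reachable x y ∨ ((x = a ∨ x = b) ∧ (y = a ∨ y = b))) :
    Nat.card G.ConnectedComponent ≤ Nat.card G'.ConnectedComponent + 1 := by
  classical
  have : Finite G'.ConnectedComponent := Quot.finite _
  -- A path in `G'` either uses only connections of `G`, or passes through `a` or `b`; then both of
  -- its ends are linked in `G` to one of the two.
  have key : ∀ x v', G'.Reachable (φ x) v' → ∀ y, φ y = v' → G.Reachable x y ∨
      ((G.Reachable x a ∨ G.Reachable x b) ∧ (G.Reachable y a ∨ G.Reachable y b)) := by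
    intro x v' hr
    rw [reachable_iff_reflTransGen] at hr
    induction hr with
    | refl =>
      intro y hy
      rw [hφ.1 hy]
      exact Or.inl (Reachable.refl _)
    | @tail u v _ hadj ih =>
      rintro y rfl
      obtain ⟨z, rfl⟩ := hφ.2 u
      rcases h z y hadj with hzy | ⟨hz, hy⟩
      · rcases ih z rfl with hxz | ⟨hx, hz⟩
        · exact Or.inl (hxz.trans hzy)
        · exact Or.inr ⟨hx, hz.imp hzy.symm.trans hzy.symm.trans⟩
      · have hy' : G.Reachable y a ∨ G.Reachable y b := by
          rcases hy with rfl | rfl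
          exacts [Or.inl (Reachable.refl _), Or.inr (Reachable.refl _)]
        refine Or.inr ⟨?_, hy'⟩
        rcases ih z rfl with hxz | ⟨hx, -⟩
        · rcases hz with rfl | rfl
          exacts [Or.inl hxz, Or.inr hxz]
        · exact hx
  -- Only the components of `a` and `b` can fuse, so sending that of `a` to `none` restores
  -- injectivity.
  let f : G.ConnectedComponent → Option G'.ConnectedComponent := fun C =>
    if C = G.connectedComponentMk a then none else some (C.map φ)
  have hf : Function.Injective f := by
    intro C D hCD
    induction C using ConnectedComponent.ind with | _ x =>
    induction D using ConnectedComponent.ind with | _ y =>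
    by_cases hx : G.connectedComponentMk x = G.connectedComponentMk a <;>
      by_cases hy : G.connectedComponentMk y = G.connectedComponentMk a
    · exact hx.trans hy.symm
    · simp [f, hx, hy] at hCD
    · simp [f, hx, hy] at hCD
    · simp only [f, if_neg hx, if_neg hy, Option.some.injEq, ConnectedComponent.map_mk,
        ConnectedComponent.eq] at hCD
      rw [ConnectedComponent.eq] at hx hy ⊢
      rcases key x _ hCD y rfl with hxy | ⟨hx', hy'⟩
      · exact hxy
      · exact (hx'.resolve_left hx).trans (hy'.resolve_left hy).symm
  simpa [Finite.card_option] using Nat.card_le_card_of_injective f hf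

/-- Adding an isolated vertex raises the number of components. -/
theorem card_connectedComponent_add_one_le [Finite V'] (φ : G →g G') (v : V')
    (hv : ∀ x, φ x ≠ v) (hiso : ∀ w, ¬ G'.Adj v w)
    (hinj : Function.Injective φ) (hsurj : ∀ w, w ≠ v → ∃ x, φ x = w)
    (h : ∀ x y, G'.Adj (φ x) (φ y) → G.Adj x y) :
    Nat.card G.ConnectedComponent + 1 ≤ Nat.card G'.ConnectedComponent := by
  have : Finite G'.ConnectedComponent := Quot.finite _
  have : Finite V := Finite.of_injective φ hinj
  have : Finite G.ConnectedComponent := Quot.finite _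
  have key : ∀ x v', G'.Reachable (φ x) v' → ∃ y, φ y = v' ∧ G.Reachable x y := by
    intro x v' hr
    rw [reachable_iff_reflTransGen] at hr
    induction hr with
    | refl => exact ⟨x, rfl, Reachable.refl _⟩
    | @tail u w _ hadj ih =>
      obtain ⟨z, rfl, hz⟩ := ih
      obtain ⟨y, rfl⟩ := hsurj w fun hw => hiso (φ z) (hw ▸ hadj.symm)
      exact ⟨y, rfl, hz.trans (h z y hadj).reachable⟩
  let f : Option G.ConnectedComponent → G'.ConnectedComponent := fun C =>
    C.elim (G'.connectedComponentMk v) (ConnectedComponent.map φ)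
  have hf : Function.Injective f := by
    have hne : ∀ C : G.ConnectedComponent, C.map φ ≠ G'.connectedComponentMk v := by
      intro C hC
      induction C using ConnectedComponent.ind with | _ x =>
      simp only [ConnectedComponent.map_mk, ConnectedComponent.eq] at hC
      obtain ⟨y, hy, -⟩ := key x v hC
      exact hv y hy
    rintro (_ | C) (_ | D) hCD
    · rfl
    · exact absurd hCD.symm (hne D)
    · exact absurd hCD (hne C)
    · induction C using ConnectedComponent.ind with | _ x =>
      induction D using ConnectedComponent.ind with | _ y =>
      simp only [f, Option.elim, ConnectedComponent.map_mk, ConnectedComponent.eq] at hCD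
      obtain ⟨z, hz, hxz⟩ := key x _ hCD
      rw [hinj hz] at hxz
      exact congrArg some (ConnectedComponent.eq.2 hxz)
  simpa [Finite.card_option] using Nat.card_le_card_of_injective f hf

end SimpleGraph

namespace PHDim

universe u

/-! ### Effect of one added simplex -/

section Steps

variable {X : Type u} {K K' : PreAbstractSimplicialComplex X} {s : Finset X}

theorem subset_mem_complex {t : Finset X} (hs : s ∈ K) (ht : t.Nonempty) (hts : t ⊆ s) : t ∈ K :=
  (K.isRelLowerSet_faces hs).2 hts ht

theorem nonempty_of_mem_complex (hs : s ∈ K) : s.Nonempty :=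
  (K.isRelLowerSet_faces hs).1

/-- The map of graphs induced by an inclusion of complexes. -/
def skeletonHom (h : K ≤ K') : skeletonGraph K →g skeletonGraph K' where
  toFun v := ⟨v.1, h v.2⟩
  map_rel' := by
    rintro v w ⟨hne, t, ht, hv, hw⟩
    exact ⟨fun hvw => hne (Subtype.ext (congrArg (fun x => x.1) hvw)), t, h ht, hv, hw⟩

theorem skeletonHom_injective (h : K ≤ K') : Function.Injective (skeletonHom h) :=
  fun _ _ hvw => Subtype.ext (congrArg (fun x => x.1) hvw)

theorem le_of_faces_eq_insert (hK : K'.faces = insert s K.faces) : K ≤ K' := fun t ht => by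
  rw [hK]
  exact Set.mem_insert_of_mem s ht

theorem mem_of_faces_eq_insert (hK : K'.faces = insert s K.faces) {t : Finset X} (ht : t ∈ K') :
    t = s ∨ t ∈ K := by
  have ht' : t ∈ K'.faces := ht
  rwa [hK] at ht'

theorem skeletonHom_surjective (hK : K'.faces = insert s K.faces) (hs : s.card ≠ 1) :
    Function.Surjective (skeletonHom (le_of_faces_eq_insert hK)) := by
  rintro ⟨v, hv⟩
  rcases mem_of_faces_eq_insert hK hv with h | h
  · exact absurd (by rw [← h, Finset.card_singleton]) hs
  · exact ⟨⟨v, h⟩, rfl⟩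

theorem numComponents_add_one_le [Finite {v : X // {v} ∈ K'}] (hK : K'.faces = insert s K.faces)
    (hs : s ∉ K) (hcard : s.card = 1) : numComponents K + 1 ≤ numComponents K' := by
  obtain ⟨v, rfl⟩ := Finset.card_eq_one.1 hcard
  have hv : {v} ∈ K' := by
    change {v} ∈ K'.faces
    rw [hK]
    exact Set.mem_insert _ _
  have hadj : ∀ x y, (skeletonGraph K').Adj x y →
      ∃ t ∈ K, x.1 ∈ t ∧ y.1 ∈ t := by
    rintro x y ⟨hne, t, ht, hx, hy⟩
    rcases mem_of_faces_eq_insert hK ht with rfl | ht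
    · rw [Finset.mem_singleton] at hx hy
      exact absurd (Subtype.ext (hx.trans hy.symm)) hne
    · exact ⟨t, ht, hx, hy⟩
  refine SimpleGraph.card_connectedComponent_add_one_le
    (skeletonHom (le_of_faces_eq_insert hK)) ⟨v, hv⟩ ?_ ?_ (skeletonHom_injective _) ?_ ?_
  · intro x hx
    have hx' : x.1 = v := congrArg (fun x => x.1) hx
    exact hs (hx' ▸ x.2)
  · intro w hw
    obtain ⟨t, ht, hvt, -⟩ := hadj _ _ hw
    exact hs (subset_mem_complex ht (Finset.singleton_nonempty v)
      (Finset.singleton_subset_iff.2 hvt))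
  · rintro ⟨w, hw⟩ hne
    rcases mem_of_faces_eq_insert hK hw with h | h
    · exact absurd (Subtype.ext (Finset.singleton_injective h)) hne
    · exact ⟨⟨w, h⟩, rfl⟩
  · intro x y hxy
    obtain ⟨t, ht, hx, hy⟩ := hadj _ _ hxy
    exact ⟨fun h => hxy.1 (by rw [h]), t, ht, hx, hy⟩

theorem numComponents_anti [Finite {v : X // {v} ∈ K}] (hK : K'.faces = insert s K.faces)
    (hcard : s.card ≠ 1) : numComponents K' ≤ numComponents K :=
  SimpleGraph.card_connectedComponent_le_of_surjective _ (skeletonHom_surjective hK hcard)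

/-- Adjacency depends only on edges, and every edge of `K'` other than `s` itself already lies in
`K`. So a new adjacency arises only when `s` is an edge, and then only between its two ends. -/
theorem numComponents_le_add_one [Finite {v : X // {v} ∈ K'}] (hK : K'.faces = insert s K.faces)
    (hcard : s.card ≠ 1) : numComponents K ≤ numComponents K' + 1 := by
  classical
  have hsK' : s ∈ K' := by
    change s ∈ K'.faces
    rw [hK]
    exact Set.mem_insert _ _
  have hlt : 1 < s.card := by
    have := (nonempty_of_mem_complex hsK').card_pos
    omega
  obtain ⟨a, b, ha, hb, hab⟩ := Finset.one_lt_card_iff.1 hlt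
  have hvert : ∀ v ∈ s, {v} ∈ K := by
    intro v hv
    refine (mem_of_faces_eq_insert hK (subset_mem_complex hsK' (Finset.singleton_nonempty v)
      (Finset.singleton_subset_iff.2 hv))).resolve_left fun h => ?_
    exact hcard (by rw [← h, Finset.card_singleton])
  refine SimpleGraph.card_connectedComponent_le_add_one
    (skeletonHom (le_of_faces_eq_insert hK))
    ⟨skeletonHom_injective _, skeletonHom_surjective hK hcard⟩ ⟨a, hvert a ha⟩ ⟨b, hvert b hb⟩ ?_
  rintro ⟨x, hxK⟩ ⟨y, hyK⟩ ⟨hne, t, ht, hx, hy⟩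
  replace hne : x ≠ y := fun h => hne (Subtype.ext h)
  change x ∈ t at hx
  change y ∈ t at hy
  have hxy : ({x, y} : Finset X) ∈ K' := subset_mem_complex ht (Finset.insert_nonempty _ _)
    (Finset.insert_subset hx (Finset.singleton_subset_iff.2 hy))
  rcases mem_of_faces_eq_insert hK hxy with rfl | h
  · right
    simp only [Finset.mem_insert, Finset.mem_singleton] at ha hb
    simp only [Subtype.mk.injEq]
    grind
  · left
    refine SimpleGraph.Adj.reachable ⟨fun h => hne (congrArg (fun x => x.1) h), _, h, ?_, ?_⟩ <;>
      simp

end Steps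

/-! ### Counting merges by telescoping -/

section Filtrations

variable {X : Type u}

theorem mem_complex_iff {L : PreAbstractSimplicialComplex X} (F : SimplexFiltration L)
    (k : Fin (F.length + 1)) (t : Finset X) :
    t ∈ F.complex k ↔ ∃ i, i.castSucc < k ∧ F.simplex i = t := by
  induction k using Fin.induction with
  | zero =>
    rw [F.complex_zero]
    exact ⟨fun h => h.elim, fun ⟨i, hi, _⟩ => absurd hi (Fin.not_lt_zero _)⟩
  | succ k ih =>
    have h : t ∈ F.complex k.succ ↔ t = F.simplex k ∨ t ∈ F.complex k.castSucc := by
      change t ∈ (F.complex k.succ).faces ↔ _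
      rw [F.complex_succ]
      exact Iff.rfl
    rw [h, ih]
    constructor
    · rintro (rfl | ⟨i, hi, rfl⟩)
      · exact ⟨k, Fin.castSucc_lt_succ, rfl⟩
      · exact ⟨i, hi.trans Fin.castSucc_lt_succ, rfl⟩
    · rintro ⟨i, hi, rfl⟩
      rcases (Fin.castSucc_lt_succ_iff.1 hi).lt_or_eq with h | h
      · exact Or.inr ⟨i, Fin.castSucc_lt_castSucc_iff.2 h, rfl⟩
      · exact Or.inl (by rw [h])

theorem simplex_mem {L : PreAbstractSimplicialComplex X} (F : SimplexFiltration L)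
    (i : Fin F.length) : F.simplex i ∈ L := by
  have h := (mem_complex_iff F (Fin.last _) _).2 ⟨i, Fin.castSucc_lt_last i, rfl⟩
  rwa [F.complex_last] at h

theorem exists_simplex_eq {L : PreAbstractSimplicialComplex X} (F : SimplexFiltration L)
    {t : Finset X} (ht : t ∈ L) : ∃ i, F.simplex i = t := by
  rw [← F.complex_last, mem_complex_iff] at ht
  exact ht.imp fun _ h => h.2

theorem complex_le {L : PreAbstractSimplicialComplex X} (F : SimplexFiltration L)
    (k : Fin (F.length + 1)) : F.complex k ≤ L := fun t ht => by
  obtain ⟨i, -, rfl⟩ := (mem_complex_iff F k t).1 ht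
  exact simplex_mem F i

theorem finite_vertices {W : Finset X} (F : SimplexFiltration (fullComplex W))
    (k : Fin (F.length + 1)) : Finite {v : X // {v} ∈ F.complex k} :=
  Finite.of_injective
    (fun v => (⟨v.1, (complex_le F k v.2).2 (Finset.mem_singleton_self _)⟩ : W))
    fun _ _ h => Subtype.ext (congrArg (fun x => x.1) h)

theorem sum_succ_sub_castSucc {n : ℕ} (f : Fin (n + 1) → ℤ) :
    ∑ i : Fin n, (f i.succ - f i.castSucc) = f (Fin.last n) - f 0 := by
  rw [Finset.sum_sub_distrib]
  have h1 := Fin.sum_univ_succ f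
  have h2 := Fin.sum_univ_castSucc f
  linarith

theorem numComponents_le_one {W : Finset X} : numComponents (fullComplex W) ≤ 1 := by
  classical
  have : (skeletonGraph (fullComplex W)).Preconnected := by
    rintro ⟨v, hv⟩ ⟨w, hw⟩
    by_cases h : v = w
    · subst h
      exact SimpleGraph.Reachable.refl _
    · refine SimpleGraph.Adj.reachable ⟨fun hvw => h (congrArg (fun x => x.1) hvw), {v, w},
        ⟨Finset.insert_nonempty _ _, ?_⟩, ?_, ?_⟩
      · exact Finset.insert_subset (hv.2 (Finset.mem_singleton_self _)) hw.2
      · simp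
      · simp
  have := this.subsingleton_connectedComponent
  exact Finite.card_le_one_iff_subsingleton.2 this

open Classical in
/-- The steps of a filtration at which two components merge. -/
noncomputable def mergeSteps {L : PreAbstractSimplicialComplex X} (F : SimplexFiltration L) :
    Finset (Fin F.length) :=
  Finset.univ.filter fun i =>
    numComponents (F.complex i.succ) + 1 = numComponents (F.complex i.castSucc)

theorem card_simplex_ne_one {W : Finset X} (F : SimplexFiltration (fullComplex W))
    {i : Fin F.length} (hi : i ∈ mergeSteps F) : (F.simplex i).card ≠ 1 := by
  classical
  intro h
  have := finite_vertices F i.succ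
  have := numComponents_add_one_le (F.complex_succ i) (F.simplex_notMem i) h
  have := (Finset.mem_filter.1 hi).2
  omega

/-- All but one of the vertices are killed by a merge. -/
theorem card_le_card_mergeSteps_add_one {W : Finset X} (F : SimplexFiltration (fullComplex W)) :
    W.card ≤ (mergeSteps F).card + 1 := by
  classical
  have htel := sum_succ_sub_castSucc fun k => (numComponents (F.complex k) : ℤ)
  rw [F.complex_last] at htel
  have hlast := numComponents_le_one (W := W)
  -- A non-vertex step loses at most one component, so if it is not a merge it loses none.
  have hstep : ∀ i : Fin F.length,
      ((if (F.simplex i).card = 1 then 1 else 0) - (if i ∈ mergeSteps F then 1 else 0) : ℤ) ≤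
        numComponents (F.complex i.succ) - numComponents (F.complex i.castSucc) := by
    intro i
    have := finite_vertices F i.succ
    by_cases h : (F.simplex i).card = 1
    · have := numComponents_add_one_le (F.complex_succ i) (F.simplex_notMem i) h
      simp only [h, if_true]
      split_ifs <;> omega
    · have := numComponents_le_add_one (F.complex_succ i) h
      have hmem : i ∈ mergeSteps F ↔
          numComponents (F.complex i.succ) + 1 = numComponents (F.complex i.castSucc) := by
        simp [mergeSteps]
      rw [if_neg h]
      split_ifs with h'
      · omega
      · rw [hmem] at h'
        omega
  have hsum := Finset.sum_le_sum fun i (_ : i ∈ Finset.univ) => hstep i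
  rw [htel, Finset.sum_sub_distrib, Finset.sum_boole, Finset.sum_boole] at hsum
  have hW : W.card ≤ (Finset.univ.filter fun i => (F.simplex i).card = 1).card := by
    choose g hg using fun v : W => exists_simplex_eq F
      (show {v.1} ∈ fullComplex W from
        ⟨Finset.singleton_nonempty _, Finset.singleton_subset_iff.2 v.2⟩)
    rw [← Fintype.card_coe W, ← Finset.card_univ]
    refine Finset.card_le_card_of_injOn g (fun v _ => ?_) fun v _ w _ hvw => ?_
    · simp [hg]
    · have := (hg v).symm.trans ((congrArg F.simplex hvw).trans (hg w))
      exact Subtype.ext (Finset.singleton_injective this)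
  have h0 : numComponents (F.complex 0) = 0 := by
    have : IsEmpty {v : X // {v} ∈ F.complex 0} :=
      ⟨fun v => by
        obtain ⟨i, hi, -⟩ := (mem_complex_iff F 0 _).1 v.2
        exact Fin.not_lt_zero _ hi⟩
    have : IsEmpty (skeletonGraph (F.complex 0)).ConnectedComponent :=
      ⟨fun C => C.ind fun v => isEmptyElim v⟩
    exact Nat.card_of_isEmpty
  have hfil : (Finset.univ.filter fun i => i ∈ mergeSteps F) = mergeSteps F := by simp
  rw [hfil, h0] at hsum
  omega

/-- From a step on after which no vertex enters, merges are bounded by the components. -/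
theorem card_mergeSteps_filter_le {W : Finset X} (F : SimplexFiltration (fullComplex W))
    (j : Fin F.length) (hj : ∀ i, j ≤ i → (F.simplex i).card ≠ 1) :
    ((mergeSteps F).filter fun i => j ≤ i).card ≤ numComponents (F.complex j.castSucc) := by
  classical
  -- Replacing `k` by its maximum with `j` freezes the count before step `j`, so only later steps
  -- contribute to the sum.
  have htel := sum_succ_sub_castSucc fun k =>
    (numComponents (F.complex (max j.castSucc k)) : ℤ)
  have hstep : ∀ i : Fin F.length,
      (numComponents (F.complex (max j.castSucc i.succ)) -
        numComponents (F.complex (max j.castSucc i.castSucc)) : ℤ) ≤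
      - (if i ∈ (mergeSteps F).filter fun i => j ≤ i then 1 else 0) := by
    intro i
    by_cases hij : j ≤ i
    · have h1 : max j.castSucc i.castSucc = i.castSucc :=
        max_eq_right (Fin.castSucc_le_castSucc_iff.2 hij)
      have h2 : max j.castSucc i.succ = i.succ :=
        max_eq_right ((Fin.castSucc_le_castSucc_iff.2 hij).trans Fin.castSucc_lt_succ.le)
      rw [h1, h2]
      have := finite_vertices F i.castSucc
      have := numComponents_anti (F.complex_succ i) (hj i hij)
      split_ifs with h
      · have := (Finset.mem_filter.1 (Finset.mem_filter.1 h).1).2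
        omega
      · omega
    · have h1 : max j.castSucc i.castSucc = j.castSucc :=
        max_eq_left (Fin.castSucc_le_castSucc_iff.2 (le_of_not_ge hij))
      have h2 : max j.castSucc i.succ = j.castSucc := max_eq_left (by
        rw [Fin.le_def]
        simp only [Fin.val_succ, Fin.val_castSucc]
        omega)
      rw [h1, h2, if_neg (by simp [hij])]
      simp
  have hsum := Finset.sum_le_sum fun i (_ : i ∈ Finset.univ) => hstep i
  rw [htel, Finset.sum_neg_distrib, Finset.sum_boole, max_eq_left (Fin.zero_le _)] at hsum
  have hfil : (Finset.univ.filter fun i => i ∈ (mergeSteps F).filter fun i => j ≤ i) =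
      (mergeSteps F).filter fun i => j ≤ i := by
    ext
    simp
  rw [hfil] at hsum
  omega

end Filtrations

/-! ### Scales of merges in Rips filtrations -/

section Rips

variable {X : Type u} [PseudoMetricSpace X]

theorem lifetimeSum_eq (α : ℝ) {W : Finset X} (F : RipsFiltration W) :
    lifetimeSum α F =
      ∑ i ∈ mergeSteps F.toSimplexFiltration, Metric.diam (F.simplex i : Set X) ^ α := by
  simp [lifetimeSum, persistentHomologyZero, mergeSteps, Finset.sum]

/-- At scale `ε` there are at most as many components as there are balls of radius `ε / 2` in a
cover. -/
theorem numComponents_le_coveringNumber {K : PreAbstractSimplicialComplex X} {W : Finset X}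
    {ε : ℝ≥0} (hKW : K ≤ fullComplex W)
    (hK : ∀ x ∈ W, ∀ y ∈ W, dist x y ≤ 2 * ε → ∃ t ∈ K, x ∈ t ∧ y ∈ t) :
    (numComponents K : ℕ∞) ≤ Metric.coveringNumber ε (Set.univ : Set X) := by
  classical
  by_cases htop : Metric.coveringNumber ε (Set.univ : Set X) = ⊤
  · rw [htop]
    exact le_top
  obtain ⟨C, -, hfin, hcov, hcard⟩ := Metric.exists_set_encard_eq_coveringNumber htop
  rw [← hcard]
  have hcen : ∀ x : X, ∃ c ∈ C, dist x c ≤ ε := by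
    intro x
    obtain ⟨c, hc, hxc⟩ := hcov (Set.mem_univ x)
    refine ⟨c, hc, ?_⟩
    have hxc : edist x c ≤ ε := hxc
    rw [edist_nndist, ENNReal.coe_le_coe] at hxc
    exact_mod_cast hxc
  choose cen hcenC hcen using hcen
  -- Each component is sent to the centre of a ball containing a chosen vertex of it.
  let f : (skeletonGraph K).ConnectedComponent → C := fun D => ⟨cen D.out.1, hcenC _⟩
  have hf : Function.Injective f := by
    intro D E hDE
    have hDE : cen D.out.1 = cen E.out.1 := congrArg (fun x => x.1) hDE
    have hdist : dist D.out.1 E.out.1 ≤ 2 * ε := by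
      have h1 := hcen D.out.1
      have h2 := hcen E.out.1
      rw [← hDE] at h2
      have := dist_triangle_right D.out.1 E.out.1 (cen D.out.1)
      linarith
    obtain ⟨t, ht, hxt, hyt⟩ := hK _ ((hKW D.out.2).2 (Finset.mem_singleton_self _)) _
      ((hKW E.out.2).2 (Finset.mem_singleton_self _)) hdist
    have hD : (skeletonGraph K).connectedComponentMk D.out = D := Quot.out_eq D
    have hE : (skeletonGraph K).connectedComponentMk E.out = E := Quot.out_eq E
    by_cases hne : D.out = E.out
    · rw [← hD, hne, hE]
    · rw [← hD, ← hE]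
      exact SimpleGraph.ConnectedComponent.connectedComponentMk_eq_of_adj ⟨hne, t, ht, hxt, hyt⟩
  have := hfin.to_subtype
  have hle : numComponents K ≤ Nat.card C := Nat.card_le_card_of_injective f hf
  rw [← hfin.cast_ncard_eq]
  exact_mod_cast hle

open Classical in
theorem card_long_merges_le {W : Finset X} (F : RipsFiltration W) (ε : ℝ≥0) :
    (((mergeSteps F.toSimplexFiltration).filter fun i =>
      2 * (ε : ℝ) < Metric.diam (F.simplex i : Set X)).card : ℕ∞) ≤
        Metric.coveringNumber ε (Set.univ : Set X) := by
  by_cases hne : ∃ i, 2 * (ε : ℝ) < Metric.diam (F.simplex i : Set X)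
  swap
  · push Not at hne
    rw [Finset.filter_false_of_mem fun i _ => not_lt.2 (hne i)]
    simp
  set S : Finset (Fin F.length) :=
    Finset.univ.filter fun i => 2 * (ε : ℝ) < Metric.diam (F.simplex i : Set X) with hS
  have hSne : S.Nonempty := by
    obtain ⟨i, hi⟩ := hne
    exact ⟨i, by simpa [hS] using hi⟩
  -- The first step of scale above 2ε; by sortedness all later steps are long too, so no vertex
  -- enters from here on and every edge of length at most 2ε is already present.
  set j := S.min' hSne with hjdef
  have hj : 2 * (ε : ℝ) < Metric.diam (F.simplex j : Set X) := by
    simpa [hS] using S.min'_mem hSne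
  have hjmin : ∀ i, 2 * (ε : ℝ) < Metric.diam (F.simplex i : Set X) → j ≤ i := fun i hi =>
    S.min'_le i (by simpa [hS] using hi)
  have hlong : ∀ i, j ≤ i → 2 * (ε : ℝ) < Metric.diam (F.simplex i : Set X) := by
    intro i hi
    have h := F.sorted hi
    simp only [Prod.Lex.toLex_le_toLex] at h
    rcases h with h | ⟨h, -⟩
    · exact hj.trans h
    · exact hj.trans_eq h
  have hcard : ∀ i, j ≤ i → (F.simplex i).card ≠ 1 := by
    intro i hi h1
    obtain ⟨v, hv⟩ := Finset.card_eq_one.1 h1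
    have h2 := hlong i hi
    rw [hv, Finset.coe_singleton, Metric.diam_singleton] at h2
    have := ε.coe_nonneg
    linarith
  have h1 : ((mergeSteps F.toSimplexFiltration).filter fun i =>
      2 * (ε : ℝ) < Metric.diam (F.simplex i : Set X)).card ≤
        numComponents (F.complex j.castSucc) := by
    refine le_trans (Finset.card_le_card ?_) (card_mergeSteps_filter_le F.toSimplexFiltration j
      hcard)
    intro i hi
    rw [Finset.mem_filter] at hi ⊢
    exact ⟨hi.1, hjmin i hi.2⟩
  refine le_trans (Nat.cast_le.2 h1) (numComponents_le_coveringNumber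
    (complex_le F.toSimplexFiltration _) fun x hx y hy hxy => ⟨{x, y}, ?_, by simp, by simp⟩)
  obtain ⟨i, hi⟩ := exists_simplex_eq F.toSimplexFiltration
    (show ({x, y} : Finset X) ∈ fullComplex W from
      ⟨Finset.insert_nonempty _ _, Finset.insert_subset hx (Finset.singleton_subset_iff.2 hy)⟩)
  refine (mem_complex_iff F.toSimplexFiltration _ _).2 ⟨i, ?_, hi⟩
  rw [Fin.castSucc_lt_castSucc_iff]
  by_contra hlt
  have := hlong i (not_lt.1 hlt)
  rw [hi, Finset.coe_pair, Metric.diam_pair] at this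
  linarith

theorem lt_diam_of_mem_mergeSteps {W : Finset X} (F : RipsFiltration W) {δ : ℝ}
    (hW : ∀ x ∈ W, ∀ y ∈ W, x ≠ y → δ < dist x y) {i : Fin F.length}
    (hi : i ∈ mergeSteps F.toSimplexFiltration) : δ < Metric.diam (F.simplex i : Set X) := by
  have hmem : F.simplex i ∈ fullComplex W := simplex_mem F.toSimplexFiltration i
  have h1 := card_simplex_ne_one F.toSimplexFiltration hi
  have h2 := hmem.1.card_pos
  obtain ⟨a, b, ha, hb, hab⟩ := Finset.one_lt_card_iff.1
    (show 1 < (F.simplex i).card by omega)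
  exact (hW a (hmem.2 ha) b (hmem.2 hb) hab).trans_le
    (Metric.dist_le_diam_of_mem (F.simplex i).finite_toSet.isBounded ha hb)

/-- A bound for the lifetime sums bounds the size of separated sets. -/
theorem card_mul_rpow_le_lifetimeSum {W : Finset X} (F : RipsFiltration W) {α δ : ℝ} (hα : 0 ≤ α)
    (hδ : 0 ≤ δ) (hW : ∀ x ∈ W, ∀ y ∈ W, x ≠ y → δ < dist x y) :
    ((W.card : ℝ) - 1) * δ ^ α ≤ lifetimeSum α F := by
  rw [lifetimeSum_eq]
  have h1 : ((W.card : ℝ) - 1) ≤ (mergeSteps F.toSimplexFiltration).card := by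
    rw [sub_le_iff_le_add]
    exact_mod_cast card_le_card_mergeSteps_add_one F.toSimplexFiltration
  calc ((W.card : ℝ) - 1) * δ ^ α ≤ (mergeSteps F.toSimplexFiltration).card * δ ^ α := by gcongr
    _ = ∑ i ∈ mergeSteps F.toSimplexFiltration, δ ^ α := by simp
    _ ≤ _ := Finset.sum_le_sum fun i hi =>
      Real.rpow_le_rpow hδ (lt_diam_of_mem_mergeSteps F hW hi).le hα

end Rips

/-- If the number of terms larger than `ε` is `O(ε ^ (-β))`, then the sum of the `α`-th powers is
bounded for `α > β`. -/
theorem sum_rpow_le_of_card_le {ι : Type*} (S : Finset ι) (d : ι → ℝ) {α β A D : ℝ} (hα : 0 < α)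
    (hβα : β < α) (hA : 0 ≤ A) (hD : 0 < D) (hd0 : ∀ i ∈ S, 0 ≤ d i) (hdD : ∀ i ∈ S, d i ≤ D)
    (hcard : ∀ ε, 0 < ε → ε ≤ D → ∀ T ⊆ S, (∀ i ∈ T, ε < d i) → (T.card : ℝ) ≤ A * ε ^ (-β)) :
    ∑ i ∈ S, d i ^ α ≤
      A * 2 ^ β * D ^ (α - β) * ∑' k : ℕ, ((1 / 2 : ℝ) ^ (α - β)) ^ k := by
  classical
  -- The dyadic level of `d i` relative to `D`; the value 0 is a dummy where no level is defined.
  have hk : ∀ i, ∃ k : ℕ, i ∈ S → 0 < d i →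
      D * (1 / 2 : ℝ) ^ (k + 1) < d i ∧ d i ≤ D * (1 / 2 : ℝ) ^ k := by
    intro i
    by_cases h : i ∈ S ∧ 0 < d i
    · obtain ⟨k, hk1, hk2⟩ := exists_nat_pow_near_of_lt_one (div_pos h.2 hD)
        ((div_le_one hD).2 (hdD i h.1)) (by norm_num : (0 : ℝ) < 1 / 2) (by norm_num)
      rw [lt_div_iff₀ hD, mul_comm] at hk1
      rw [div_le_iff₀ hD, mul_comm] at hk2
      exact ⟨k, fun _ _ => ⟨hk1, hk2⟩⟩
    · exact ⟨0, fun h1 h2 => absurd ⟨h1, h2⟩ h⟩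
  choose k hk using hk
  have hr0 : (0 : ℝ) < (1 / 2 : ℝ) ^ (α - β) := by positivity
  have hr1 : (1 / 2 : ℝ) ^ (α - β) < 1 :=
    Real.rpow_lt_one (by norm_num) (by norm_num) (by linarith)
  have hsummable := summable_geometric_of_lt_one hr0.le hr1
  set S' := S.filter fun i => 0 < d i with hS'
  have hS'mem : ∀ i ∈ S', i ∈ S ∧ 0 < d i := fun i hi => Finset.mem_filter.1 hi
  have h1 : ∑ i ∈ S, d i ^ α = ∑ i ∈ S', d i ^ α := by
    refine (Finset.sum_subset (Finset.filter_subset _ _) fun i hi hi' => ?_).symm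
    have : d i = 0 := le_antisymm
      (not_lt.1 fun h => hi' (Finset.mem_filter.2 ⟨hi, h⟩)) (hd0 i hi)
    rw [this, Real.zero_rpow hα.ne']
  have hfiber : ∀ n : ℕ, ∑ i ∈ S' with k i = n, d i ^ α ≤
      A * 2 ^ β * D ^ (α - β) * ((1 / 2 : ℝ) ^ (α - β)) ^ n := by
    intro n
    have hc := hcard (D * (1 / 2 : ℝ) ^ (n + 1)) (by positivity)
      (mul_le_of_le_one_right hD.le (pow_le_one₀ (by norm_num) (by norm_num)))
      (S'.filter fun i => k i = n)
      ((Finset.filter_subset _ _).trans (Finset.filter_subset _ _)) (by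
        intro i hi
        rw [Finset.mem_filter] at hi
        obtain ⟨hi, rfl⟩ := hi
        exact (hk i (hS'mem i hi).1 (hS'mem i hi).2).1)
    -- The terms are counted at the lower end of the dyadic interval and estimated at the upper end;
    -- this mismatch produces the factor `2 ^ β`.
    have hpow : (D * (1 / 2 : ℝ) ^ (n + 1)) ^ (-β) * (D * (1 / 2 : ℝ) ^ n) ^ α =
        2 ^ β * D ^ (α - β) * ((1 / 2 : ℝ) ^ (α - β)) ^ n := by
      have e1 : D * (1 / 2 : ℝ) ^ (n + 1) = (D * (1 / 2 : ℝ) ^ n) * 2⁻¹ := by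
        rw [pow_succ]
        ring
      have hpos : 0 < D * (1 / 2 : ℝ) ^ n := by positivity
      rw [e1, Real.mul_rpow hpos.le (by norm_num), Real.inv_rpow (by norm_num),
        Real.rpow_neg (zero_le_two : (0 : ℝ) ≤ 2), inv_inv, mul_right_comm, ← Real.rpow_add hpos,
        Real.mul_rpow hD.le (by positivity), ← Real.rpow_natCast ((1 / 2 : ℝ) ^ (α - β)),
        ← Real.rpow_natCast (1 / 2 : ℝ), ← Real.rpow_mul (by norm_num),
        ← Real.rpow_mul (by norm_num), mul_comm (n : ℝ), neg_add_eq_sub]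
      ring
    calc ∑ i ∈ S' with k i = n, d i ^ α
        ≤ ∑ i ∈ S' with k i = n, (D * (1 / 2 : ℝ) ^ n) ^ α := by
          refine Finset.sum_le_sum fun i hi => ?_
          rw [Finset.mem_filter] at hi
          obtain ⟨hi, rfl⟩ := hi
          exact Real.rpow_le_rpow (hS'mem i hi).2.le (hk i (hS'mem i hi).1 (hS'mem i hi).2).2 hα.le
      _ = (S'.filter fun i => k i = n).card * (D * (1 / 2 : ℝ) ^ n) ^ α := by
          rw [Finset.sum_const, nsmul_eq_mul]
      _ ≤ A * (D * (1 / 2 : ℝ) ^ (n + 1)) ^ (-β) * (D * (1 / 2 : ℝ) ^ n) ^ α := by gcongr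
      _ = _ := by rw [mul_assoc A, hpow]; ring
  rw [h1, ← Finset.sum_fiberwise_of_maps_to (t := S'.image k)
    fun i hi => Finset.mem_image_of_mem k hi]
  refine (Finset.sum_le_sum fun n _ => hfiber n).trans ?_
  rw [← Finset.mul_sum]
  gcongr
  exact hsummable.sum_le_tsum _ fun n _ => by positivity

/-! ### From counting estimates to dimensions -/

variable {X : Type u} [PseudoMetricSpace X]

/-- Polynomial growth of the covering numbers bounds the lifetime sums. -/
theorem exists_lifetimeSum_lt [BoundedSpace X] {α β δ₀ : ℝ} (hβ : 0 < β) (hβα : β < α)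
    (hδ₀ : 0 < δ₀)
    (h : ∀ δ : ℝ≥0, 0 < δ → δ ≤ δ₀ →
      ((Metric.coveringNumber δ (Set.univ : Set X) : ℕ∞) : ℝ≥0∞) ≤
        ENNReal.ofReal ((δ : ℝ) ^ (-β))) :
    ∃ C : ℝ, 0 < C ∧ ∀ (W : Finset X) (F : RipsFiltration W), lifetimeSum α F < C := by
  classical
  -- The summand `2 * δ₀` makes `q = D / δ₀` at least 2. For ε ≤ D the radius ε / q is then at most
  -- `δ₀`, where the hypothesis applies, and at most ε / 2, as the merge count needs. The rescaling
  -- costs `q ^ β`.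
  set D : ℝ := Metric.diam (Set.univ : Set X) + 2 * δ₀ with hDdef
  have hdiam : 0 ≤ Metric.diam (Set.univ : Set X) := Metric.diam_nonneg
  have hD : 0 < D := by positivity
  set q : ℝ := D / δ₀ with hq
  have hq2 : 2 ≤ q := by
    rw [hq, le_div_iff₀ hδ₀]
    linarith
  have hq0 : 0 < q := by linarith
  set B : ℝ := q ^ β * 2 ^ β * D ^ (α - β) * ∑' k : ℕ, ((1 / 2 : ℝ) ^ (α - β)) ^ k with hB
  have hB0 : 0 ≤ B := mul_nonneg (by positivity) (tsum_nonneg fun _ => by positivity)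
  refine ⟨B + 1, by positivity, fun W F => lt_of_le_of_lt ?_ (lt_add_one B)⟩
  rw [lifetimeSum_eq]
  refine sum_rpow_le_of_card_le _ _ (hβ.trans hβα) hβα (by positivity) hD
    (fun i _ => Metric.diam_nonneg) (fun i _ => ?_) fun ε hε hεD T hT hTε => ?_
  · have := Metric.diam_mono (Set.subset_univ (F.simplex i : Set X))
      (Bornology.IsBounded.all _)
    linarith
  · have hεq : 0 < ε / q := by positivity
    let η : ℝ≥0 := ⟨ε / q, hεq.le⟩
    have hη : (η : ℝ) = ε / q := rfl
    have hηδ : (η : ℝ) ≤ δ₀ := by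
      rw [hη, div_le_iff₀ hq0, hq, mul_div_cancel₀ _ hδ₀.ne']
      exact hεD
    have hη2 : 2 * (η : ℝ) ≤ ε := by
      rw [hη, ← mul_div_assoc, div_le_iff₀ hq0]
      nlinarith
    have h1 : (T.card : ℕ∞) ≤ Metric.coveringNumber η (Set.univ : Set X) := by
      refine le_trans (Nat.cast_le.2 (Finset.card_le_card fun i hi => ?_))
        (card_long_merges_le F η)
      exact Finset.mem_filter.2 ⟨hT hi, hη2.trans_lt (hTε i hi)⟩
    have h2 : ((T.card : ℕ) : ℝ≥0∞) ≤ ENNReal.ofReal ((η : ℝ) ^ (-β)) := by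
      refine le_trans ?_ (h η hεq hηδ)
      exact_mod_cast ENat.toENNReal_le.2 h1
    rw [← ENNReal.ofReal_natCast, ENNReal.ofReal_le_ofReal_iff (by positivity)] at h2
    refine h2.trans_eq ?_
    rw [hη, Real.div_rpow hε.le hq0.le, Real.rpow_neg hq0.le, div_inv_eq_mul, mul_comm]

/-- A bound for the lifetime sums bounds the covering numbers. -/
theorem coveringNumber_le_of_lifetimeSum_lt {α C : ℝ} (hα : 0 < α)
    (h : ∀ (W : Finset X) (F : RipsFiltration W), lifetimeSum α F < C) {δ : ℝ≥0} (hδ : 0 < δ) :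
    ((Metric.coveringNumber δ (Set.univ : Set X) : ℕ∞) : ℝ≥0∞) ≤
      ENNReal.ofReal (1 + C * (δ : ℝ) ^ (-α)) := by
  have hδ' : 0 < (δ : ℝ) := hδ
  have hfin : ∀ W : Finset X, Metric.IsSeparated (δ : ℝ≥0∞) (W : Set X) →
      (W.card : ℝ) ≤ 1 + C * (δ : ℝ) ^ (-α) := by
    intro W hW
    obtain ⟨F⟩ := nonempty_ripsFiltration W
    have h1 := card_mul_rpow_le_lifetimeSum F hα.le hδ'.le fun x hx y hy hxy => by
      have : (δ : ℝ≥0∞) < edist x y := hW hx hy hxy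
      rw [edist_nndist, ENNReal.coe_lt_coe] at this
      exact_mod_cast this
    have h2 : ((W.card : ℝ) - 1) * (δ : ℝ) ^ α ≤ C := h1.trans (h W F).le
    rw [← le_div_iff₀ (by positivity)] at h2
    rw [Real.rpow_neg hδ'.le, ← div_eq_mul_inv]
    linarith
  set R : ℝ := 1 + C * (δ : ℝ) ^ (-α) with hR
  have hR0 : 0 ≤ R := by
    have := hfin ∅ (by simp [Metric.IsSeparated])
    simpa using this
  have hpack : Metric.packingNumber δ (Set.univ : Set X) ≤ (⌊R⌋₊ : ℕ∞) := by
    refine iSup_le fun S => iSup_le fun _ => iSup_le fun hS => ?_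
    by_contra hlt
    rw [not_le] at hlt
    -- The separated set `S` may be infinite, so a finite subset that is just too large is
    -- extracted.
    obtain ⟨T, hTS, hT⟩ := Set.exists_subset_encard_eq (Order.add_one_le_of_lt hlt)
    have hTfin : T.Finite := Set.finite_of_encard_eq_coe (k := ⌊R⌋₊ + 1) (by rw [hT]; simp)
    have h1 := hfin hTfin.toFinset (by
      rw [hTfin.coe_toFinset]
      exact hS.subset hTS)
    have h2 : hTfin.toFinset.card = ⌊R⌋₊ + 1 := by
      rw [hTfin.encard_eq_coe_toFinset_card] at hT
      exact_mod_cast hT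
    rw [h2] at h1
    push_cast at h1
    linarith [Nat.lt_floor_add_one R]
  have hcov := (Metric.coveringNumber_le_packingNumber δ (Set.univ : Set X)).trans hpack
  have h3 : ((Metric.coveringNumber δ (Set.univ : Set X) : ℕ∞) : ℝ≥0∞) ≤ ((⌊R⌋₊ : ℕ) : ℝ≥0∞) := by
    exact_mod_cast ENat.toENNReal_le.2 hcov
  refine h3.trans ?_
  rw [← ENNReal.ofReal_natCast]
  exact ENNReal.ofReal_le_ofReal (Nat.floor_le hR0)

/-- At least one ball is needed since the space is non-empty. This makes any exponent above the
dimension positive. -/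
theorem upperBoxDim_nonneg [Nonempty X] : 0 ≤ upperBoxDim X := by
  refine le_limsup_of_frequently_le (Eventually.frequently ?_)
  have hlt : ∀ᶠ δ : ℝ≥0 in 𝓝[>] 0, δ < 1 :=
    nhdsWithin_le_nhds (Iio_mem_nhds zero_lt_one)
  filter_upwards [hlt, self_mem_nhdsWithin] with δ hδ1 hδ0
  have hδ0' : 0 < (δ : ℝ) := hδ0
  have hδ1' : (δ : ℝ) < 1 := hδ1
  refine EReal.div_nonneg ?_ ?_
  · rw [ENNReal.zero_le_log_iff]
    have h1 : 1 ≤ Metric.coveringNumber δ (Set.univ : Set X) :=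
      Order.one_le_iff_pos.2 (Metric.coveringNumber_pos_iff.2 Set.univ_nonempty)
    exact_mod_cast ENat.toENNReal_le.2 h1
  · exact EReal.coe_nonneg.2 (Real.log_nonneg (by rw [le_div_iff₀ hδ0']; linarith))

theorem upperBoxDim_le_of_lifetimeSum_lt {α C : ℝ} (hα : 0 < α) (hC : 0 < C)
    (h : ∀ (W : Finset X) (F : RipsFiltration W), lifetimeSum α F < C) :
    upperBoxDim X ≤ α := by
  have hlt : ∀ᶠ δ : ℝ≥0 in 𝓝[>] 0, δ < 1 :=
    nhdsWithin_le_nhds (Iio_mem_nhds zero_lt_one)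
  have hcoe : Tendsto (fun δ : ℝ≥0 => (δ : ℝ)) (𝓝[>] 0) (𝓝[>] 0) := by
    refine tendsto_nhdsWithin_iff.2 ⟨?_, ?_⟩
    · exact (NNReal.continuous_coe.tendsto' 0 0 rfl).mono_left nhdsWithin_le_nhds
    · filter_upwards [self_mem_nhdsWithin] with δ hδ
      exact_mod_cast hδ
  have hlog : Tendsto (fun δ : ℝ≥0 => Real.log (1 / (δ : ℝ))) (𝓝[>] 0) atTop := by
    have := (Real.tendsto_log_atTop.comp tendsto_inv_nhdsGT_zero).comp hcoe
    refine this.congr fun δ => ?_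
    simp
  have hlim : Tendsto (fun δ : ℝ≥0 =>
      ((Real.log (1 + C) / Real.log (1 / (δ : ℝ)) + α : ℝ) : EReal)) (𝓝[>] 0) (𝓝 (α : EReal)) := by
    refine (continuous_coe_real_ereal.tendsto α).comp ?_
    simpa using (hlog.const_div_atTop (Real.log (1 + C))).add_const α
  rw [← hlim.limsup_eq]
  refine limsup_le_limsup ?_
  filter_upwards [hlt, self_mem_nhdsWithin] with δ hδ1 hδ0
  have hδ0' : 0 < (δ : ℝ) := hδ0
  have hδ1' : (δ : ℝ) < 1 := hδ1
  have hL : 0 < Real.log (1 / (δ : ℝ)) := Real.log_pos (by rw [lt_div_iff₀ hδ0']; linarith)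
  rw [EReal.div_le_iff_le_mul (by exact_mod_cast hL) (EReal.coe_ne_top _)]
  have hpow : 1 ≤ (δ : ℝ) ^ (-α) :=
    Real.one_le_rpow_of_pos_of_le_one_of_nonpos hδ0' hδ1'.le (by linarith)
  -- Since δ^(-α) ≥ 1, the summand 1 is absorbed into the constant, which disappears in the limit
  -- after division by log (1/δ).
  have h1 : ((Metric.coveringNumber δ (Set.univ : Set X) : ℕ∞) : ℝ≥0∞) ≤
      ENNReal.ofReal ((1 + C) * (δ : ℝ) ^ (-α)) :=
    (coveringNumber_le_of_lifetimeSum_lt hα h hδ0).trans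
      (ENNReal.ofReal_le_ofReal (by nlinarith))
  refine (ENNReal.log_monotone h1).trans ?_
  rw [ENNReal.log_ofReal_of_pos (by positivity), ← EReal.coe_mul, EReal.coe_le_coe_iff,
    Real.log_mul (by positivity) (by positivity), Real.log_rpow hδ0', mul_add,
    mul_div_cancel₀ _ hL.ne', one_div, Real.log_inv]
  linarith

theorem exists_lifetimeSum_lt_of_upperBoxDim_lt [BoundedSpace X] {α β : ℝ} (hβ : 0 < β)
    (hβα : β < α) (h : upperBoxDim X < β) :
    ∃ C : ℝ, 0 < C ∧ ∀ (W : Finset X) (F : RipsFiltration W), lifetimeSum α F < C := by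
  have hlt : ∀ᶠ δ : ℝ≥0 in 𝓝[>] 0, δ < 1 :=
    nhdsWithin_le_nhds (Iio_mem_nhds zero_lt_one)
  have hev := (eventually_lt_of_limsup_lt h).and hlt
  rw [eventually_nhdsWithin_iff, NNReal.nhds_zero_basis.eventually_iff] at hev
  obtain ⟨r, hr0, hr⟩ := hev
  have hr0' : 0 < (r : ℝ) := hr0
  refine exists_lifetimeSum_lt hβ hβα (δ₀ := r / 2) (by positivity) fun δ hδ hδr => ?_
  have hδ0' : 0 < (δ : ℝ) := hδ
  have hδr' : δ < r := by
    have : (δ : ℝ) < r := by linarith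
    exact_mod_cast this
  obtain ⟨h1, h2⟩ := hr hδr' hδ
  have hδ1' : (δ : ℝ) < 1 := h2
  have hL : 0 < Real.log (1 / (δ : ℝ)) := Real.log_pos (by rw [lt_div_iff₀ hδ0']; linarith)
  rw [EReal.div_lt_iff (by exact_mod_cast hL) (EReal.coe_ne_top _)] at h1
  rw [← ENNReal.log_le_log_iff, ENNReal.log_ofReal_of_pos (by positivity), Real.log_rpow hδ0']
  refine h1.le.trans_eq ?_
  rw [← EReal.coe_mul, one_div, Real.log_inv]
  congr 1
  ring

end PHDim

theorem theorem4p1 {X : Type*} [PseudoMetricSpace X] [BoundedSpace X] [Nonempty X] :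
    PHDim.upperBoxDim X = PHDim.phDimZero X := by
  refine le_antisymm (le_sInf ?_) (le_of_forall_gt fun c hc => ?_)
  · rintro _ ⟨α, rfl, hα, C, hC, h⟩
    exact PHDim.upperBoxDim_le_of_lifetimeSum_lt hα hC h
  -- Two exponents are interpolated: β controls the covering numbers, and the gap α - β makes the
  -- dyadic series converge.
  · obtain ⟨α, hα, hαc⟩ := EReal.lt_iff_exists_real_btwn.1 hc
    obtain ⟨β, hβ, hβα⟩ := EReal.lt_iff_exists_real_btwn.1 hα
    have hβ0 : 0 < β := EReal.coe_pos.1 (PHDim.upperBoxDim_nonneg.trans_lt hβ)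
    have hβα' : β < α := EReal.coe_lt_coe_iff.1 hβα
    refine lt_of_le_of_lt (sInf_le ?_) hαc
    exact ⟨α, rfl, hβ0.trans hβα',
      PHDim.exists_lifetimeSum_lt_of_upperBoxDim_lt hβ0 hβα' hβ⟩
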